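/- Let $\Bbbk$ be a field and $N\ge 3$. The affine nilTemperley-Lieb algebra $\widehat{\mathrm{nTL}}_N$ is the unital associative $\Bbbk$-algebra with generators $a_i$, $i\in\mathbb Z/N\mathbb Z$, and relations $a_i^2=0$, $a_ia_{i+1}a_i=a_{i+1}a_ia_{i+1}=0$ for all $i$, and $a_ia_j=a_ja_i$ whenever $i-j\ne\pm1$ in $\mathbb Z/N\mathbb Z$. A monomial is a product of generators. A particle configuration is a set $I=\{1\le i_1<\dots<i_k\le N\}$ of sites, regarded as a subset of $\mathbb Z/N\mathbb Z$. The algebra acts on $\Bbbk[q]\otimes\bigwedge\Bbbk^N$, with $\Bbbk[q]$-basis $v(I)=v_{i_1}\wedge\dots\wedge v_{i_k}$, as follows: $a_jv(I)=0$ if $j\notin I$ or $j+1\in I$; otherwise $a_jv(I)=v((I\setminus\{j\})\cup\{j+1\})$ if $j\ne0$, and $a_0v(I)=(-1)^{k-1}q\,v((I\setminus\{0\})\cup\{1\})$. Thus $a_j$ moves a particle one step from site $j$ to site $j+1$. For configurations $I,J$ with $|I|=|J|=k$, $1\le k\le N-1$, let $e_{IJ}$ be the monomial with $e_{IJ}v(J)=\pm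 q^m v(I)$ that moves every particle of $J$ by at least one step and for which $m$ is minimal among all such monomials. For $|I|=k$ with $1\le k\le N-1$ choose $g\in I$ with $g+1\notin I$, and let $a(\hat I)$ be the monomial $$a(\hat I)=\Big(\prod_{r=0,\dots,N-1,\ g-r\notin I}a_{g-r}\Big)\Big(\prod_{r=1,\dots,N,\ g+r\in I}a_{g+r}\Big),$$ where in both products the factors are written from left to right in order of increasing $r$. For $1\le k\le N-1$ put $t_k=(-1)^{k-1}\sum_{|I|=k}a(\hat I)$. Then the monomial $e_{IJ}$ exists and is unique as an element of the algebra, $a(\hat I)$ does not depend on the choice of $g$, and $e_{II}=a(\hat I)$. Each $t_k^\ell e_{IJ}$ with $|I|=|J|=k$ equals $(-1)^{\ell(k-1)}$ times a monomial, and the elements $$1,\qquad t_k^\ell e_{IJ}\quad(\ell\ge0,\ 1\le k\le N-1,\ |I|=|J|=k),$$ which are pairwise distinct for distinct labels $(\ell,I,J)$, form a $\Bbbk$-basis of $\widehat{\mathrm{nTL}}_N$. -/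

import Mathlib

open Polynomial

namespace AffNTL

/-- The defining relations of the affine nilTemperley-Lieb algebra on generators `a_i`, `i ∈ ℤ/N`. -/
inductive Rel (𝕜 : Type*) [Field 𝕜] (N : ℕ) :
    FreeAlgebra 𝕜 (ZMod N) → FreeAlgebra 𝕜 (ZMod N) → Prop
  | sq (i : ZMod N) : Rel 𝕜 N (FreeAlgebra.ι 𝕜 i * FreeAlgebra.ι 𝕜 i) 0
  | comm (i j : ZMod N) (h₁ : i - j ≠ 1) (h₂ : i - j ≠ -1) :
      Rel 𝕜 N (FreeAlgebra.ι 𝕜 i * FreeAlgebra.ι 𝕜 j) (FreeAlgebra.ι 𝕜 j * FreeAlgebra.ι 𝕜 i)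
  | braid (i : ZMod N) :
      Rel 𝕜 N (FreeAlgebra.ι 𝕜 i * FreeAlgebra.ι 𝕜 (i + 1) * FreeAlgebra.ι 𝕜 i) 0
  | braid' (i : ZMod N) :
      Rel 𝕜 N (FreeAlgebra.ι 𝕜 (i + 1) * FreeAlgebra.ι 𝕜 i * FreeAlgebra.ι 𝕜 (i + 1)) 0

/-- The affine nilTemperley-Lieb algebra of rank `N` over `𝕜`. -/
abbrev Alg (𝕜 : Type*) [Field 𝕜] (N : ℕ) : Type _ := RingQuot (Rel 𝕜 N)

/-- The generator `a_i`. -/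
noncomputable def gen (𝕜 : Type*) [Field 𝕜] (N : ℕ) (i : ZMod N) : Alg 𝕜 N :=
  RingQuot.mkAlgHom 𝕜 (Rel 𝕜 N) (FreeAlgebra.ι 𝕜 i)

/-- The monomial `a(j₁,…,j_m) = a_{j₁} ⋯ a_{j_m}`. -/
noncomputable def mono (𝕜 : Type*) [Field 𝕜] (N : ℕ) (w : List (ZMod N)) : Alg 𝕜 N :=
  (w.map (gen 𝕜 N)).prod

/-- A particle configuration on the circle with sites `ℤ/N` (the site `N` is identified with `0`):
the set of occupied sites.  The increasing sequence `1 ≤ i₁ < ⋯ < i_k ≤ N` is the set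
`{i₁, …, i_k}`. -/
abbrev Config (N : ℕ) : Type := Finset (ZMod N)

/-- The space `𝕜[q] ⊗ ⋀ 𝕜^N`, in coordinates with respect to its standard `𝕜[q]`-basis of wedges
`v(I) = v_{i₁} ∧ ⋯ ∧ v_{i_k}`, `1 ≤ i₁ < ⋯ < i_k ≤ N`. -/
abbrev Fock (𝕜 : Type*) [Field 𝕜] (N : ℕ) : Type _ := Config N →₀ 𝕜[X]

/-- The standard basis vector `v(I)`. -/
noncomputable def wedge (𝕜 : Type*) [Field 𝕜] (N : ℕ) (I : Config N) : Fock 𝕜 N :=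
  Finsupp.single I 1

/-- The action of `a_j` on the space of particle configurations: `v_j` is replaced by `v_{j+1}`
(which gives `0` if `j` is not occupied, or if `j + 1` is occupied already).
For `j ≠ 0` the wedge remains increasing.  For `j = 0`, the last factor `v_N` is
replaced by `q • v_1`, and moving `v_1` to the front produces the sign `(-1)^(k-1)`. -/
noncomputable def genAct (𝕜 : Type*) [Field 𝕜] (N : ℕ) (j : ZMod N) :
    Module.End 𝕜[X] (Fock 𝕜 N) :=
  Finsupp.linearCombination 𝕜[X] fun I : Config N =>
    if j ∈ I ∧ j + 1 ∉ I then
      (if j = 0 then (-1) ^ (I.card - 1) * X else 1 : 𝕜[X]) •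
        wedge 𝕜 N (insert (j + 1) (I.erase j))
    else 0

/-- The action of a monomial `a_{j₁} ⋯ a_{j_m}` (its rightmost factor acts first). -/
noncomputable def wordAct (𝕜 : Type*) [Field 𝕜] (N : ℕ) (w : List (ZMod N)) :
    Module.End 𝕜[X] (Fock 𝕜 N) :=
  (w.map (genAct 𝕜 N)).prod

/-- The number of steps by which the word `w` (rightmost letter first) moves a particle that starts
at the site `x`: a letter `j` moves it one step exactly if it sits at `j` at that time. -/
def steps (N : ℕ) : List (ZMod N) → ZMod N → ℕ
  | [], _ => 0
  | j :: w, x => steps N w x + if x + (steps N w x : ZMod N) = j then 1 else 0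

/-- The monomial with word `w` maps `v(J)` to `± q^m v(I)`, and it moves every particle of `J` by
at least one step. -/
def Moves (𝕜 : Type*) [Field 𝕜] (N : ℕ) (w : List (ZMod N)) (I J : Config N) (m : ℕ) : Prop :=
  (wordAct 𝕜 N w (wedge 𝕜 N J) = (X ^ m : 𝕜[X]) • wedge 𝕜 N I ∨
    wordAct 𝕜 N w (wedge 𝕜 N J) = -((X ^ m : 𝕜[X]) • wedge 𝕜 N I)) ∧
  ∀ j ∈ J, 1 ≤ steps N w j

/-- `x` is a monomial that moves the particles at `J` to the positions `I`, every particle by at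
least one step, with the minimal power of `q`. -/
def IsMinMono (𝕜 : Type*) [Field 𝕜] (N : ℕ) (I J : Config N) (x : Alg 𝕜 N) : Prop :=
  ∃ (w : List (ZMod N)) (m : ℕ), x = mono 𝕜 N w ∧ Moves 𝕜 N w I J m ∧
    ∀ (w' : List (ZMod N)) (m' : ℕ), Moves 𝕜 N w' I J m' → m ≤ m'

open Classical in
/-- The monomial `e_{IJ}` (with the value `0` if there is none). -/
noncomputable def e (𝕜 : Type*) [Field 𝕜] (N : ℕ) (I J : Config N) : Alg 𝕜 N :=
  if h : ∃ x, IsMinMono 𝕜 N I J x then h.choose else 0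

/-- The word of the special monomial `a(Î)`, for a site `g = i_ℓ ∈ I` followed by a gap.
Right part, which acts first: `i_{ℓ+1}, …, i_k, i₁, …, i_ℓ`, the occupied sites in clockwise order
starting after `g`; it moves every particle by one step.
Left part: the empty sites in counterclockwise order starting before `g`; this is the
concatenation of the (pairwise commuting) strands `i_{s+1} - 1, …, i_s + 2, i_s + 1`, each of which
carries a particle from `i_s + 1` to `i_{s+1}`. -/
def hatWord (N : ℕ) (I : Config N) (g : ZMod N) : List (ZMod N) :=
  let clockwise : List (ZMod N) := (List.range N).map fun t => g + 1 + (t : ZMod N)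
  clockwise.reverse.filter (fun i => i ∉ I) ++ clockwise.filter (fun i => i ∈ I)

open Classical in
/-- The special monomial `a(Î)`, formed with some gap of `I`. -/
noncomputable def aHat (𝕜 : Type*) [Field 𝕜] (N : ℕ) (I : Config N) : Alg 𝕜 N :=
  if h : ∃ g, g ∈ I ∧ g + 1 ∉ I then mono 𝕜 N (hatWord N I h.choose) else 0

/-- The central element `t_k = (-1)^(k-1) ∑_{|I| = k} a(Î)`. -/
noncomputable def t (𝕜 : Type*) [Field 𝕜] (N : ℕ) [NeZero N] (k : ℕ) : Alg 𝕜 N :=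
  (-1 : 𝕜) ^ (k - 1) •
    ∑ I ∈ Finset.powersetCard k (Finset.univ : Finset (ZMod N)), aHat 𝕜 N I

/-- Pairs `(I, J)` of particle configurations with `1 ≤ |I| = |J| ≤ N - 1`. -/
abbrev ConfigPair (N : ℕ) : Type :=
  {p : Config N × Config N // p.1.card = p.2.card ∧ 1 ≤ p.1.card ∧ p.1.card ≤ N - 1}

end AffNTL

namespace AffNTL

/-! A word acts on configurations as a partial map (`Path`, scalars dropped), and this classifies
the nonzero monomials. A nonzero monomial acts on some configuration `J` all of whose particles it
moves (`exists_path_of_mono_ne_zero`), and this `J` lies in every configuration on which the word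
acts (`subset_of_path`). Conservation of particles at each site fixes the differences of
neighbouring letter counts, so the endpoints together with the number of letters `0`, which is the
exponent of `q`, fix all counts (`count_eq_of_path`). Endpoints and counts fix the monomial
(`mono_eq_of_path`). Nonzero monomials other than `1` are thus labelled by `I`, `J` and the exponent
`d`.

For given `I`, `J` the least `d` gives `e_{IJ}`. When `t_k` multiplies a monomial that moves all of
`J` to `I`, only the summand `a(Î)` survives (`t_mul_mono`); it leads from `I` back to `I` and
raises `d` by one. Hence powers of `t_k` reach every larger `d`, and the family spans. Independence
is read off in the representation from the coefficient of `q^d v(I)` in `x v(J)`. This is triangular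
in `|J|`, since a monomial with moved configuration `J'` kills `v(J)` unless `J' ⊆ J`. -/

variable {𝕜 : Type*} [Field 𝕜] {N : ℕ}

/-! ### Vanishing and commutation of monomials -/

section Relations

theorem gen_mul_self (i : ZMod N) : gen 𝕜 N i * gen 𝕜 N i = 0 := by
  have h := RingQuot.mkAlgHom_rel 𝕜 (Rel.sq (𝕜 := 𝕜) i)
  rwa [map_zero, map_mul] at h

theorem gen_comm {i j : ZMod N} (h₁ : i - j ≠ 1) (h₂ : i - j ≠ -1) :
    gen 𝕜 N i * gen 𝕜 N j = gen 𝕜 N j * gen 𝕜 N i := by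
  have h := RingQuot.mkAlgHom_rel 𝕜 (Rel.comm (𝕜 := 𝕜) i j h₁ h₂)
  rwa [map_mul, map_mul] at h

theorem gen_braid (i : ZMod N) : gen 𝕜 N i * gen 𝕜 N (i + 1) * gen 𝕜 N i = 0 := by
  have h := RingQuot.mkAlgHom_rel 𝕜 (Rel.braid (𝕜 := 𝕜) i)
  rwa [map_zero, map_mul, map_mul] at h

theorem gen_braid' (i : ZMod N) : gen 𝕜 N (i + 1) * gen 𝕜 N i * gen 𝕜 N (i + 1) = 0 := by
  have h := RingQuot.mkAlgHom_rel 𝕜 (Rel.braid' (𝕜 := 𝕜) i)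
  rwa [map_zero, map_mul, map_mul] at h

@[simp] theorem mono_nil : mono 𝕜 N [] = 1 := by simp [mono]

@[simp] theorem mono_cons (j : ZMod N) (w : List (ZMod N)) :
    mono 𝕜 N (j :: w) = gen 𝕜 N j * mono 𝕜 N w := by simp [mono]

@[simp] theorem mono_append (u w : List (ZMod N)) :
    mono 𝕜 N (u ++ w) = mono 𝕜 N u * mono 𝕜 N w := by simp [mono]

theorem commute_gen_mono {j : ZMod N} {p : List (ZMod N)} (h₁ : j - 1 ∉ p) (h₂ : j + 1 ∉ p) :
    Commute (gen 𝕜 N j) (mono 𝕜 N p) := by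
  induction p with
  | nil => simp
  | cons a p ih =>
    simp only [List.mem_cons, not_or] at h₁ h₂
    rw [mono_cons]
    refine Commute.mul_right (gen_comm (fun h => h₁.1 ?_) (fun h => h₂.1 ?_)) (ih h₁.2 h₂.2)
    · rw [← h]; ring
    · rw [eq_comm, ← sub_eq_zero, ← neg_eq_zero]; linear_combination h

theorem mono_eq_zero_of_separated {j i : ZMod N} {p₁ p₂ : List (ZMod N)} (r : List (ZMod N))
    (h : gen 𝕜 N j * gen 𝕜 N i * gen 𝕜 N j = 0)
    (h₁ : j - 1 ∉ p₁) (h₂ : j + 1 ∉ p₁) (h₃ : j - 1 ∉ p₂) (h₄ : j + 1 ∉ p₂) :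
    mono 𝕜 N (j :: ((p₁ ++ i :: p₂) ++ j :: r)) = 0 := by
  have c₁ := (commute_gen_mono (𝕜 := 𝕜) h₁ h₂).eq
  have c₂ := (commute_gen_mono (𝕜 := 𝕜) h₃ h₄).eq
  simp only [mono_cons, mono_append]
  calc _ = gen 𝕜 N j * mono 𝕜 N p₁ * gen 𝕜 N i * (mono 𝕜 N p₂ * gen 𝕜 N j) * mono 𝕜 N r := by
        noncomm_ring
    _ = mono 𝕜 N p₁ * (gen 𝕜 N j * gen 𝕜 N i * gen 𝕜 N j) * mono 𝕜 N p₂ * mono 𝕜 N r := by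
        rw [c₁, ← c₂]; noncomm_ring
    _ = 0 := by rw [h]; simp

/-- Two letters `j` with at most one neighbouring letter between them give a vanishing monomial. -/
theorem mono_eq_zero_of_count {j : ZMod N} {p : List (ZMod N)} (r : List (ZMod N))
    (h : p.count (j - 1) + p.count (j + 1) ≤ 1) (hj : (j - 1 : ZMod N) ≠ j + 1) :
    mono 𝕜 N (j :: (p ++ j :: r)) = 0 := by
  by_cases h₁ : j - 1 ∈ p
  · obtain ⟨p₁, p₂, rfl⟩ := List.append_of_mem h₁
    simp only [List.count_append, List.count_cons_self, List.count_cons_of_ne hj] at h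
    refine mono_eq_zero_of_separated r ?_ ?_ ?_ ?_ ?_
    · have := gen_braid' (𝕜 := 𝕜) (j - 1)
      rwa [sub_add_cancel] at this
    all_goals exact List.count_eq_zero.1 (by omega)
  by_cases h₂ : j + 1 ∈ p
  · obtain ⟨p₁, p₂, rfl⟩ := List.append_of_mem h₂
    simp only [List.count_append, List.count_cons_self, List.count_cons_of_ne hj.symm] at h
    refine mono_eq_zero_of_separated r (gen_braid j) ?_ ?_ ?_ ?_
    all_goals exact List.count_eq_zero.1 (by omega)
  have c := (commute_gen_mono (𝕜 := 𝕜) h₁ h₂).eq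
  simp only [mono_cons, mono_append]
  rw [← mul_assoc, c, mul_assoc, ← mul_assoc (gen 𝕜 N j), gen_mul_self]
  simp

end Relations

/-! ### Words as partial maps on configurations -/

/-- The word `w` (rightmost letter first) moves the configuration `J` to `I`. -/
def Path : List (ZMod N) → Config N → Config N → Prop
  | [], J, I => I = J
  | j :: w, J, I => ∃ K, Path w J K ∧ j ∈ K ∧ j + 1 ∉ K ∧ I = insert (j + 1) (K.erase j)

theorem path_append {u w : List (ZMod N)} {J I : Config N} :
    Path (u ++ w) J I ↔ ∃ K, Path w J K ∧ Path u K I := by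
  induction u generalizing I with
  | nil => simp [Path]
  | cons j u ih =>
    simp only [List.cons_append, Path, ih]
    constructor
    · rintro ⟨K, ⟨L, h₁, h₂⟩, h₃⟩; exact ⟨L, h₁, K, h₂, h₃⟩
    · rintro ⟨L, h₁, K, h₂, h₃⟩; exact ⟨K, ⟨L, h₁, h₂⟩, h₃⟩

theorem path_singleton {j : ZMod N} {J I : Config N} :
    Path [j] J I ↔ j ∈ J ∧ j + 1 ∉ J ∧ I = insert (j + 1) (J.erase j) := by
  simp [Path]

theorem Path.unique {w : List (ZMod N)} {J I I' : Config N} (h : Path w J I) (h' : Path w J I') :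
    I = I' := by
  induction w generalizing I I' with
  | nil => exact Eq.trans h (Eq.symm h')
  | cons j w ih =>
    obtain ⟨K, h₁, -, -, rfl⟩ := h
    obtain ⟨K', h₁', -, -, rfl⟩ := h'
    rw [ih h₁ h₁']

theorem Path.card_eq {w : List (ZMod N)} {J I : Config N} (h : Path w J I) :
    I.card = J.card := by
  induction w generalizing I with
  | nil => exact congrArg _ h
  | cons j w ih =>
    obtain ⟨K, h₁, h₂, h₃, rfl⟩ := h
    rw [Finset.card_insert_of_notMem (fun h => h₃ (Finset.mem_of_mem_erase h)),
      Finset.card_erase_add_one h₂, ih h₁]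

/-- Words act from the right, so the leftmost `j` is the one applied last and `p` is what happens
afterwards. -/
theorem exists_last_split {j : ZMod N} {w : List (ZMod N)} (h : j ∈ w) :
    ∃ p r, w = p ++ j :: r ∧ j ∉ p := by
  obtain ⟨p, r, h₁, h₂⟩ := List.eq_append_cons_of_mem h
  exact ⟨p, r, h₁, h₂⟩

/-- A spectator at `j` never moves, because `j ∉ u`, and never blocks another particle, because no
letter `j - 1` tries to enter its site. -/
theorem path_insert {u : List (ZMod N)} {J K : Config N} {j : ZMod N} (h : Path u J K)
    (h₁ : j ∉ u) (h₂ : j - 1 ∉ u) : Path u (insert j J) (insert j K) := by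
  induction u generalizing K with
  | nil => obtain rfl : K = J := h; rfl
  | cons a u ih =>
    simp only [List.mem_cons, not_or] at h₁ h₂
    obtain ⟨L, hL, l₁, l₂, rfl⟩ := h
    have ha : a + 1 ≠ j := fun h => h₂.1 (by rw [← h]; ring)
    refine ⟨_, ih hL h₁.2 h₂.2, by simp [l₁], by simp [l₂, ha], ?_⟩
    rw [Finset.erase_insert_of_ne h₁.1, Finset.insert_comm]

/-! ### Letter counts and the classification of nonzero monomials -/

section Large

variable (hN : 3 ≤ N)
include hN

theorem one_ne_zero_of_three_le : (1 : ZMod N) ≠ 0 := by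
  intro h
  have := (ZMod.natCast_eq_zero_iff 1 N).1 (by exact_mod_cast h)
  have := Nat.le_of_dvd one_pos this
  omega

theorem two_ne_zero_of_three_le : (2 : ZMod N) ≠ 0 := by
  intro h
  have := (ZMod.natCast_eq_zero_iff 2 N).1 (by exact_mod_cast h)
  have := Nat.le_of_dvd two_pos this
  omega

theorem add_one_ne (j : ZMod N) : j + 1 ≠ j := by
  simpa using one_ne_zero_of_three_le hN

theorem sub_one_ne (j : ZMod N) : j - 1 ≠ j := by
  simpa using one_ne_zero_of_three_le hN

theorem sub_one_ne_add_one (j : ZMod N) : j - 1 ≠ j + 1 := fun h =>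
  two_ne_zero_of_three_le hN (by linear_combination -h)

/-- The number of particles at the site `x` changes by the number of arrivals and departures. -/
theorem Path.conservation {w : List (ZMod N)} {J I : Config N} (h : Path w J I) (x : ZMod N) :
    (if x ∈ I then 1 else 0) + w.count x = (if x ∈ J then 1 else 0) + w.count (x - 1) := by
  induction w generalizing I with
  | nil => obtain rfl : I = J := h; simp
  | cons j w ih =>
    obtain ⟨K, h₁, h₂, h₃, rfl⟩ := h
    have := ih h₁
    have hj := add_one_ne hN j
    rcases eq_or_ne x j with rfl | hx
    · rw [List.count_cons_self, List.count_cons_of_ne (sub_one_ne hN x).symm]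
      rw [if_pos h₂] at this
      rw [if_neg (by simp [hj.symm])]
      omega
    · rw [List.count_cons_of_ne hx.symm]
      rcases eq_or_ne x (j + 1) with rfl | hx'
      · rw [if_neg h₃] at this
        rw [if_pos (by simp), add_sub_cancel_right, List.count_cons_self]
        rw [add_sub_cancel_right] at this
        omega
      · rw [List.count_cons_of_ne (fun h => hx' (by rw [h]; ring))]
        simpa [hx, hx'] using this

theorem path_swap {a j : ZMod N} {J I : Config N} (h : Path [a, j] J I)
    (h₀ : a ≠ j) (h₁ : a ≠ j - 1) (h₂ : a ≠ j + 1) : Path [j, a] J I := by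
  have e₀ := add_one_ne hN a
  have e₁ := add_one_ne hN j
  have h₁' : a + 1 ≠ j := fun h => h₁ (by rw [← h]; ring)
  obtain ⟨K, h, ha, ha', rfl⟩ := h
  obtain ⟨hj, hj', rfl⟩ := path_singleton.1 h
  simp only [Finset.mem_insert, Finset.mem_erase, not_or, not_and, ne_eq] at ha ha'
  have haJ : a ∈ J := by tauto
  have haJ' : a + 1 ∉ J := by tauto
  refine ⟨_, path_singleton.2 ⟨haJ, haJ', rfl⟩, ?_, ?_, ?_⟩
  · simp [Ne.symm h₀, hj]
  · simp [Ne.symm h₀, hj']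
  · ext x
    simp only [Finset.mem_insert, Finset.mem_erase]
    by_cases q₁ : x = a + 1 <;> by_cases q₂ : x = j + 1 <;> by_cases q₃ : x = a <;>
      by_cases q₄ : x = j <;> simp_all

theorem path_move_front {p r : List (ZMod N)} {j : ZMod N} {J I : Config N}
    (h : Path (p ++ j :: r) J I) (h₀ : j ∉ p) (h₁ : j - 1 ∉ p) (h₂ : j + 1 ∉ p) :
    Path (j :: (p ++ r)) J I := by
  induction p generalizing I with
  | nil => exact h
  | cons a p ih =>
    simp only [List.mem_cons, not_or] at h₀ h₁ h₂
    obtain ⟨K, h, hK⟩ := h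
    have h' := ih h h₀.2 h₁.2 h₂.2
    have : Path ([a, j] ++ (p ++ r)) J I := ⟨K, h', hK⟩
    obtain ⟨L, hL, hL'⟩ := path_append.1 this
    exact path_append (u := [j, a]).2
      ⟨L, hL, path_swap hN hL' (Ne.symm h₀.1) (Ne.symm h₁.1) (Ne.symm h₂.1)⟩

/-- After its last use, a letter `j` has seen as many neighbours as the final configuration
prescribes. -/
theorem count_after_last {p r : List (ZMod N)} {j : ZMod N} {J I : Config N}
    (h : Path (p ++ j :: r) J I) (h₀ : j ∉ p) :
    p.count (j - 1) = (if j ∈ I then 1 else 0) ∧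
      (if j + 1 ∈ I then 1 else 0) + p.count (j + 1) = 1 := by
  obtain ⟨K, ⟨L, hL, h₁, h₂, rfl⟩, hK⟩ := path_append.1 h
  have c₁ := hK.conservation hN j
  have c₂ := hK.conservation hN (j + 1)
  have l₁ : j ∉ insert (j + 1) (L.erase j) := by simp [(add_one_ne hN j).symm]
  have l₂ : j + 1 ∈ insert (j + 1) (L.erase j) := by simp
  rw [if_neg l₁, List.count_eq_zero.2 h₀] at c₁
  rw [if_pos l₂, add_sub_cancel_right, List.count_eq_zero.2 h₀] at c₂
  omega

/-- A monomial that moves `J` to `I` is determined by the number of its letters of each kind. -/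
theorem mono_eq_of_path {w w' : List (ZMod N)} {J I : Config N} (h : Path w J I)
    (h' : Path w' J I) (hc : ∀ x, w.count x = w'.count x) : mono 𝕜 N w = mono 𝕜 N w' := by
  induction w generalizing w' I with
  | nil =>
    obtain rfl : w' = [] := List.eq_nil_iff_forall_not_mem.2 fun x hx => by
      have := hc x
      simp only [List.count_nil] at this
      exact List.count_eq_zero.1 this.symm hx
    rfl
  | cons j u ih =>
    have hj : j ∈ w' := List.count_pos_iff.1 (by rw [← hc]; simp)
    obtain ⟨p, r, rfl, hp⟩ := exists_last_split hj
    -- The word `j :: u` ends with a step from `j`, so `I` has `j` empty and `j + 1` occupied. Hence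
    -- no neighbour of `j` follows the last `j` of `w'`, and that `j` can be pulled to the front and
    -- cancelled.
    obtain ⟨c₁, c₂⟩ := count_after_last hN h' hp
    obtain ⟨K, hK, k₁, k₂, rfl⟩ := h
    rw [if_neg (by simp [(add_one_ne hN j).symm])] at c₁
    rw [if_pos (by simp)] at c₂
    have hp₁ : j - 1 ∉ p := List.count_eq_zero.1 c₁
    have hp₂ : j + 1 ∉ p := List.count_eq_zero.1 (by omega)
    obtain ⟨K', hK', k₁', k₂', e⟩ := path_move_front hN h' hp hp₁ hp₂
    have hKK : K' = K := by
      ext x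
      have e' := Finset.ext_iff.1 e x
      simp only [Finset.mem_insert, Finset.mem_erase] at e'
      by_cases q₁ : x = j <;> by_cases q₂ : x = j + 1 <;> simp_all
    subst hKK
    have hc' : ∀ x, u.count x = (p ++ r).count x := fun x => by
      have := hc x
      simp only [List.count_cons, List.count_append] at this ⊢
      omega
    rw [mono_cons, ih hK hK' hc', mono_append, mono_append, mono_cons, ← mul_assoc,
      (commute_gen_mono hp₁ hp₂).eq, mul_assoc]

/-- A nonzero monomial moves all the particles of some configuration. -/
theorem exists_path_of_mono_ne_zero {w : List (ZMod N)} (hw : mono 𝕜 N w ≠ 0) :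
    ∃ J I, Path w J I ∧ ∀ x ∈ J, x ∈ w := by
  induction w with
  | nil => exact ⟨∅, ∅, rfl, by simp⟩
  | cons j u ih =>
    obtain ⟨J, K, hK, hJ⟩ := ih fun h => hw (by rw [mono_cons, h, mul_zero])
    by_cases hj : j ∈ K ∧ j + 1 ∉ K
    · exact ⟨J, _, ⟨K, hK, hj.1, hj.2, rfl⟩, fun x hx => List.mem_cons_of_mem _ (hJ x hx)⟩
    -- If `j` cannot act on `K` but occurs in `u`, at most one neighbouring letter separates the two
    -- uses of `j`, and the monomial vanishes.
    by_cases hu : j ∈ u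
    · obtain ⟨p, r, rfl, hp⟩ := exists_last_split hu
      obtain ⟨c₁, c₂⟩ := count_after_last hN hK hp
      refine absurd (mono_eq_zero_of_count r ?_ (sub_one_ne_add_one hN j)) hw
      by_cases k₁ : j ∈ K <;> by_cases k₂ : j + 1 ∈ K <;> simp_all
    -- Here `j` is a new letter. A particle at `j + 1` in `K` would have stood there unmoved from
    -- the start, contrary to `hJ`; so a fresh particle can be added at `j`.
    have hjJ : j ∉ J := fun h => hu (hJ j h)
    have c₁ := hK.conservation hN j
    have c₂ := hK.conservation hN (j + 1)
    rw [if_neg hjJ, List.count_eq_zero.2 hu] at c₁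
    rw [add_sub_cancel_right, List.count_eq_zero.2 hu] at c₂
    have k₂ : j + 1 ∉ K := fun h => by
      rw [if_pos h] at c₂
      by_cases h' : j + 1 ∈ J
      · have := List.count_pos_iff.2 (hJ _ h')
        rw [if_pos h'] at c₂
        omega
      · rw [if_neg h'] at c₂
        omega
    have k₁ : j ∉ K := fun h => hj ⟨h, k₂⟩
    rw [if_neg k₁] at c₁
    have hu' : j - 1 ∉ u := List.count_eq_zero.1 (by omega)
    refine ⟨insert j J, _, ⟨_, path_insert hK hu hu', by simp, ?_, rfl⟩, ?_⟩
    · simp [k₂, one_ne_zero_of_three_le hN]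
    · intro x hx
      rcases Finset.mem_insert.1 hx with rfl | hx
      · simp
      · exact List.mem_cons_of_mem _ (hJ x hx)

/-- The configuration of particles moved by a word is the smallest one on which it acts. -/
theorem subset_of_path {w : List (ZMod N)} {J I J' I' : Config N} (h : Path w J I)
    (h' : Path w J' I') (hJ : ∀ x ∈ J, x ∈ w) : J ⊆ J' := by
  suffices ∀ x ∈ w, x ∈ J → x ∈ J' from fun x hx => this x (hJ x hx) hx
  clear hJ
  intro x hx hxJ
  induction w generalizing I I' with
  | nil => simp at hx
  | cons j u ih =>
    obtain ⟨K, hK, k₁, k₂, rfl⟩ := h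
    obtain ⟨K', hK', k₁', k₂', rfl⟩ := h'
    by_cases hu : x ∈ u
    · exact ih hK hK' hu
    obtain rfl : x = j := by simpa [hu] using hx
    -- Up to the first use of `x`, the path from `J` shows that no letter `x - 1` occurs. So the
    -- particle that this letter needs at `x` cannot have arrived and must already be in `J'`.
    by_contra hxJ'
    have c := hK.conservation hN x
    have c' := hK'.conservation hN x
    rw [if_pos k₁, if_pos hxJ] at c
    rw [if_pos k₁', if_neg hxJ'] at c'
    omega

/-- The number of letters of each kind is determined by the number of letters `0`. -/
theorem count_eq_of_path {w w' : List (ZMod N)} {J I : Config N} (h : Path w J I)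
    (h' : Path w' J I) (h₀ : w.count 0 = w'.count 0) (x : ZMod N) : w.count x = w'.count x := by
  have : NeZero N := ⟨by omega⟩
  -- Walk around the circle from site `0`; conservation passes the equality from each site to the
  -- next.
  rw [← ZMod.natCast_zmod_val x]
  induction x.val with
  | zero => simpa using h₀
  | succ n ih =>
    have c := h.conservation hN ((n + 1 : ℕ) : ZMod N)
    have c' := h'.conservation hN ((n + 1 : ℕ) : ZMod N)
    rw [show ((n + 1 : ℕ) : ZMod N) - 1 = (n : ZMod N) by push_cast; ring] at c c'
    omega

end Large

/-! ### The action in terms of paths and letter counts -/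

section Action

theorem genAct_wedge (j : ZMod N) (I : Config N) :
    genAct 𝕜 N j (wedge 𝕜 N I) =
      if j ∈ I ∧ j + 1 ∉ I then
        (if j = 0 then (-1) ^ (I.card - 1) * X else 1 : 𝕜[X]) •
          wedge 𝕜 N (insert (j + 1) (I.erase j))
      else 0 := by
  rw [genAct, wedge, Finsupp.linearCombination_single, one_smul]

theorem wordAct_cons (j : ZMod N) (w : List (ZMod N)) (v : Fock 𝕜 N) :
    wordAct 𝕜 N (j :: w) v = genAct 𝕜 N j (wordAct 𝕜 N w v) := by
  simp [wordAct]

theorem wordAct_of_path {w : List (ZMod N)} {J I : Config N} (h : Path w J I) :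
    wordAct 𝕜 N w (wedge 𝕜 N J) =
      ((-1) ^ (J.card - 1) * X : 𝕜[X]) ^ w.count 0 • wedge 𝕜 N I := by
  induction w generalizing I with
  | nil => obtain rfl : I = J := h; simp [wordAct]
  | cons j w ih =>
    obtain ⟨K, hK, k₁, k₂, rfl⟩ := h
    rw [wordAct_cons, ih hK, map_smul, genAct_wedge, if_pos ⟨k₁, k₂⟩, smul_smul, hK.card_eq]
    by_cases hj : j = 0
    · subst hj
      rw [if_pos rfl, List.count_cons_self, pow_succ]
    · rw [if_neg hj, List.count_cons_of_ne hj, mul_one]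

theorem wordAct_of_forall_not_path {w : List (ZMod N)} {J : Config N}
    (h : ∀ I, ¬ Path w J I) : wordAct 𝕜 N w (wedge 𝕜 N J) = 0 := by
  induction w with
  | nil => exact absurd rfl (h J)
  | cons j w ih =>
    rw [wordAct_cons]
    by_cases hw : ∃ K, Path w J K
    · obtain ⟨K, hK⟩ := hw
      rw [wordAct_of_path hK, map_smul, genAct_wedge, if_neg fun k => h _ ⟨K, hK, k.1, k.2, rfl⟩,
        smul_zero]
    · rw [ih (not_exists.1 hw), map_zero]

/-- Until its first step the particle stays at `x`, so the first letter `x` is what moves it. -/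
theorem one_le_steps_iff {w : List (ZMod N)} {x : ZMod N} : 1 ≤ steps N w x ↔ x ∈ w := by
  induction w with
  | nil => simp [steps]
  | cons j w ih =>
    rw [steps, List.mem_cons, ← ih]
    by_cases h : steps N w x = 0
    · simp [h, Nat.one_le_iff_ne_zero]
    · constructor <;> intro <;> omega

theorem neg_one_pow_mul_X_pow (a m : ℕ) :
    ((-1) ^ a * X : 𝕜[X]) ^ m = X ^ m ∨ ((-1) ^ a * X : 𝕜[X]) ^ m = -X ^ m := by
  rw [mul_pow, ← pow_mul]
  rcases neg_one_pow_eq_or 𝕜[X] (a * m) with h | h <;> simp [h]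

theorem smul_wedge_apply (f : 𝕜[X]) (I : Config N) : (f • wedge 𝕜 N I) I = f := by
  simp [wedge]

theorem smul_wedge_apply_of_ne (f : 𝕜[X]) {I I' : Config N} (h : I' ≠ I) :
    (f • wedge 𝕜 N I) I' = 0 := by
  simp [wedge, h]

theorem moves_iff {w : List (ZMod N)} {J I : Config N} {m : ℕ} :
    Moves 𝕜 N w I J m ↔ Path w J I ∧ w.count 0 = m ∧ ∀ x ∈ J, x ∈ w := by
  simp only [Moves, one_le_steps_iff]
  refine ⟨fun ⟨h, hJ⟩ => ?_, fun ⟨h, hm, hJ⟩ => ⟨?_, hJ⟩⟩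
  · obtain ⟨f, hf, hf'⟩ : ∃ f : 𝕜[X], wordAct 𝕜 N w (wedge 𝕜 N J) = f • wedge 𝕜 N I ∧
        (f = X ^ m ∨ f = -X ^ m) := by
      rcases h with h | h
      · exact ⟨_, h, Or.inl rfl⟩
      · exact ⟨-X ^ m, by rw [h, neg_smul], Or.inr rfl⟩
    -- The degree recovers the exponent whatever the sign, even in characteristic two.
    have hd : f.natDegree = m := by rcases hf' with rfl | rfl <;> simp
    have h₀ : f ≠ 0 := by rcases hf' with rfl | rfl <;> simp
    by_cases hp : ∃ K, Path w J K
    · obtain ⟨K, hK⟩ := hp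
      rw [wordAct_of_path hK] at hf
      have hKI : I = K := by
        by_contra hne
        apply h₀
        rw [← smul_wedge_apply f I, ← hf, smul_wedge_apply_of_ne _ hne]
      subst hKI
      refine ⟨hK, ?_, hJ⟩
      have := congrArg (fun v : Fock 𝕜 N => v I) hf
      simp only [smul_wedge_apply] at this
      rw [← hd, ← this]
      rcases neg_one_pow_mul_X_pow (𝕜 := 𝕜) (J.card - 1) (w.count 0) with e | e <;> simp [e]
    · rw [wordAct_of_forall_not_path (not_exists.1 hp)] at hf
      exact absurd (by rw [← smul_wedge_apply f I, ← hf]; rfl) h₀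
  · rw [wordAct_of_path h, hm]
    rcases neg_one_pow_mul_X_pow (𝕜 := 𝕜) (J.card - 1) m with e | e <;> simp [e]

end Action

/-! ### The special monomials as closed paths -/

section HatWord

variable (hN : 3 ≤ N)
include hN

/-- A word without repetitions moves `I` if each of its letters is preceded by the one that
provides a particle, or by the one that provides a gap. -/
theorem path_of_nodup {w : List (ZMod N)} {I : Config N} (hw : w.Nodup)
    (h : ∀ u, u <:+ w → ∀ x, (x ∈ I → x - 1 ∈ u → x ∈ u) ∧ (x ∉ I → x ∈ u → x - 1 ∈ u)) :
    ∃ K, Path w I K ∧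
      ∀ x, x ∈ K ↔ (x ∈ I ∧ (x ∈ w → x - 1 ∈ w)) ∨ (x ∉ I ∧ x - 1 ∈ w ∧ x ∉ w) := by
  induction w with
  | nil => exact ⟨I, rfl, by simp⟩
  | cons j u ih =>
    rw [List.nodup_cons] at hw
    obtain ⟨K, hK, hx⟩ := ih hw.2 fun v hv => h v (hv.trans (List.suffix_cons j u))
    have h' := h (j :: u) List.suffix_rfl
    have hu := h u (List.suffix_cons j u)
    have e₁ := sub_one_ne hN j
    have e₂ := add_one_ne hN j
    have k₁ : j ∈ K := by
      rw [hx]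
      have := h' j
      simp only [List.mem_cons, e₁, false_or, true_or, true_imp_iff] at this
      have := hw.1
      tauto
    have k₂ : j + 1 ∉ K := by
      rw [hx, add_sub_cancel_right]
      have := h' (j + 1)
      simp only [List.mem_cons, e₂, false_or, true_or, true_imp_iff, add_sub_cancel_right] at this
      have := hw.1
      tauto
    refine ⟨_, ⟨K, hK, k₁, k₂, rfl⟩, fun x => ?_⟩
    have k₁' := (hx j).1 k₁
    have k₂' := mt (hx (j + 1)).2 k₂
    rw [add_sub_cancel_right] at k₂'
    simp only [Finset.mem_insert, Finset.mem_erase, List.mem_cons]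
    rcases eq_or_ne x j with rfl | hxj
    · have h₁ := hw.1
      have h₂ := h' x
      have h₃ := hu x
      simp only [List.mem_cons, e₁, e₂.symm, false_or, true_or, true_imp_iff, ne_eq,
        not_true_eq_false, false_and, false_iff] at h₂ h₃ ⊢
      clear h ih hx hu h' k₂' k₂ hK
      grind
    rcases eq_or_ne x (j + 1) with rfl | hxj'
    · have h₁ := hw.1
      have h₂ := h' (j + 1)
      have h₃ := hu (j + 1)
      simp only [List.mem_cons, e₂, false_or, true_or, true_imp_iff, ne_eq,
        not_false_eq_true, true_iff, add_sub_cancel_right] at h₂ h₃ ⊢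
      clear h ih hx hu h' k₁' k₁ k₂ hK
      grind
    · have : x - 1 ≠ j := fun h => hxj' (by rw [← h]; ring)
      simp [hx, hxj, hxj', this]

/-- The sites in clockwise order, starting after `g`. -/
def clockwise (N : ℕ) (g : ZMod N) : List (ZMod N) :=
  (List.range N).map fun t : ℕ => g + 1 + (t : ZMod N)

omit hN in
theorem hatWord_eq (I : Config N) (g : ZMod N) :
    hatWord N I g = ((clockwise N g).filter (· ∉ I)).reverse ++ (clockwise N g).filter (· ∈ I) := by
  simp [hatWord, clockwise, List.filter_reverse, ← List.map_eq_flatMap, Function.comp_def]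

theorem mem_clockwise (g x : ZMod N) : x ∈ clockwise N g := by
  have : NeZero N := ⟨by omega⟩
  refine List.mem_map.2 ⟨(x - g - 1).val, List.mem_range.2 (ZMod.val_lt _), ?_⟩
  rw [ZMod.natCast_zmod_val]; ring

omit hN in
theorem nodup_clockwise (g : ZMod N) : (clockwise N g).Nodup := by
  refine List.Nodup.map_on (fun a ha b hb h => ?_) List.nodup_range
  have := (ZMod.natCast_eq_natCast_iff' a b N).1 (add_left_cancel h)
  rwa [Nat.mod_eq_of_lt (List.mem_range.1 ha), Nat.mod_eq_of_lt (List.mem_range.1 hb)] at this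

omit hN in
theorem mem_prefix_clockwise [NeZero N] {g x : ZMod N} {a : List (ZMod N)}
    (h : a <+: clockwise N g) : x ∈ a ↔ (x - g - 1).val < a.length := by
  have hl : a.length ≤ N := by simpa [clockwise] using h.length_le
  have he := List.prefix_iff_eq_take.1 h
  rw [clockwise, ← List.map_take, List.take_range, min_eq_left hl] at he
  conv_lhs => rw [he]
  simp only [List.mem_map, List.mem_range]
  constructor
  · rintro ⟨t, ht, rfl⟩
    rw [show g + 1 + (t : ZMod N) - g - 1 = t by ring, ZMod.val_natCast_of_lt (by omega)]
    exact ht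
  · intro ht
    exact ⟨_, ht, by rw [ZMod.natCast_zmod_val]; ring⟩

/-- A prefix is an arc that starts at `g + 1`, so only its first site can lack its predecessor. -/
theorem sub_one_mem_of_prefix_clockwise {g x : ZMod N} {a : List (ZMod N)}
    (h : a <+: clockwise N g) (hx : x ∈ a) (hg : x ≠ g + 1) : x - 1 ∈ a := by
  have : NeZero N := ⟨by omega⟩
  have : Fact (1 < N) := ⟨by omega⟩
  rw [mem_prefix_clockwise h] at hx ⊢
  have h₀ : (x - g - 1).val ≠ 0 := fun h => hg (by
    rw [ZMod.val_eq_zero] at h; linear_combination h)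
  rw [show x - 1 - g - 1 = (x - g - 1) - 1 by ring, ZMod.val_sub (by rw [ZMod.val_one]; omega)]
  omega

omit hN in
theorem suffix_append_cases {α : Type*} {u a b : List α} (h : u <:+ a ++ b) :
    u <:+ b ∨ ∃ v, v <:+ a ∧ u = v ++ b := by
  obtain ⟨t, ht⟩ := h
  rcases List.append_eq_append_iff.1 ht with ⟨c, h₁, h₂⟩ | ⟨c, h₁, h₂⟩
  · exact Or.inr ⟨c, ⟨t, h₁.symm⟩, h₂⟩
  · exact Or.inl ⟨c, h₂.symm⟩

theorem mem_hatWord (I : Config N) (g x : ZMod N) : x ∈ hatWord N I g := by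
  rw [hatWord_eq]
  have := mem_clockwise hN g x
  by_cases x ∈ I <;> simp_all

omit hN in
theorem nodup_hatWord (I : Config N) (g : ZMod N) : (hatWord N I g).Nodup := by
  rw [hatWord_eq]
  refine List.Nodup.append (List.nodup_reverse.2 ((nodup_clockwise g).filter _))
    ((nodup_clockwise g).filter _) fun x h₁ h₂ => ?_
  simp_all

/-- An occupied site is vacated before its predecessor moves, and an empty one is filled before it
is emptied. The cyclic order could break this only at `g + 1`; there the site is empty and `g`
supplies its particle. -/
theorem path_hatWord {I : Config N} {g : ZMod N} (hg : g ∈ I) (hg' : g + 1 ∉ I) :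
    Path (hatWord N I g) I I := by
  obtain ⟨K, hK, hx⟩ := path_of_nodup hN (I := I) (nodup_hatWord I g) (by
    intro u hu x
    rw [hatWord_eq] at hu
    rcases suffix_append_cases hu with hu | ⟨v, hv, rfl⟩
    · obtain ⟨b, ⟨a, hab⟩, rfl⟩ := List.suffix_filter_iff.1 hu
      have hb : ∀ y, y ∈ b ↔ y ∉ a := fun y => by
        have h₁ := nodup_clockwise g (N := N)
        have h₂ := mem_clockwise hN g y
        rw [← hab] at h₁ h₂
        have h₃ := List.disjoint_of_nodup_append h₁
        constructor
        · exact fun h h' => h₃ h' h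
        · exact fun h => (List.mem_append.1 h₂).resolve_left h
      have hp := @sub_one_mem_of_prefix_clockwise N hN g x a ⟨b, hab⟩
      simp only [List.mem_filter, decide_eq_true_eq, hb]
      refine ⟨fun hx h => ⟨fun h' => h.1 (hp h' ?_), hx⟩, fun h h' => absurd h'.2 h⟩
      rintro rfl
      exact hg' hx
    · rw [← List.reverse_prefix, List.reverse_reverse] at hv
      obtain ⟨a, ha, hva⟩ := List.prefix_filter_iff.1 hv
      obtain rfl : v = (a.filter (· ∉ I)).reverse := by rw [← hva, List.reverse_reverse]
      have hp := @sub_one_mem_of_prefix_clockwise N hN g x a ha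
      simp only [List.mem_append, List.mem_reverse, List.mem_filter, decide_eq_true_eq,
        mem_clockwise hN g, true_and]
      refine ⟨fun hx h => Or.inr hx, fun hx h => ?_⟩
      by_cases hxI : x - 1 ∈ I
      · exact Or.inr hxI
      · refine Or.inl ⟨hp (by tauto) ?_, hxI⟩
        rintro rfl
        simp_all)
  have : K = I := by
    ext x
    rw [hx]
    simp [mem_hatWord hN I g]
  rwa [this] at hK

theorem count_hatWord (I : Config N) (g x : ZMod N) : (hatWord N I g).count x = 1 :=
  List.count_eq_one_of_mem (nodup_hatWord I g) (mem_hatWord hN I g x)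

end HatWord

/-! ### Connectedness of configurations of equal size -/

section Reachability

variable (hN : 3 ≤ N)
include hN

/-- The word of the special monomial at `g` moves the particle at `g` first. -/
theorem hatWord_eq_append {I : Config N} {g : ZMod N} (hg : g ∈ I) :
    ∃ u, hatWord N I g = u ++ [g] := by
  obtain ⟨n, rfl⟩ : ∃ n, N = n + 1 := ⟨N - 1, by omega⟩
  have : g + 1 + (n : ZMod (n + 1)) = g := by
    have := ZMod.natCast_self (n + 1)
    push_cast at this
    linear_combination this
  refine ⟨((clockwise (n + 1) g).filter (· ∉ I)).reverse ++
    ((List.range n).map fun t : ℕ => g + 1 + (t : ZMod (n + 1))).filter (· ∈ I), ?_⟩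
  rw [hatWord_eq, List.append_assoc]
  congr 1
  rw [clockwise, List.range_succ, List.map_append, List.filter_append]
  simp [this, hg]

/-- Every single step can be undone by further steps. -/
theorem exists_path_return {J : Config N} {j : ZMod N} (h₁ : j ∈ J) (h₂ : j + 1 ∉ J) :
    ∃ w, Path w (insert (j + 1) (J.erase j)) J := by
  -- The closed path of the special monomial at `j` begins with the step to be undone; its remainder
  -- leads back.
  obtain ⟨u, hu⟩ := hatWord_eq_append hN h₁
  have h := path_hatWord hN h₁ h₂
  rw [hu] at h
  obtain ⟨K, hK, hu⟩ := path_append.1 h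
  obtain ⟨-, -, rfl⟩ := path_singleton.1 hK
  exact ⟨u, hu⟩

theorem exists_path_swap (J : Config N) (j : ZMod N) :
    ∃ w, Path w J (J.map (Equiv.swap j (j + 1)).toEmbedding) := by
  have e := add_one_ne hN j
  have hm : ∀ x, x ∈ J.map (Equiv.swap j (j + 1)).toEmbedding ↔ Equiv.swap j (j + 1) x ∈ J :=
    fun x => by
      rw [Finset.mem_map_equiv, Equiv.symm_swap]
  by_cases h₁ : j ∈ J <;> by_cases h₂ : j + 1 ∈ J
  · refine ⟨[], ?_⟩
    ext x
    rw [hm]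
    rcases eq_or_ne x j with rfl | h <;> [skip; rcases eq_or_ne x (j + 1) with rfl | h'] <;>
      simp_all [Equiv.swap_apply_of_ne_of_ne]
  · refine ⟨[j], path_singleton.2 ⟨h₁, h₂, ?_⟩⟩
    ext x
    rw [hm]
    rcases eq_or_ne x j with rfl | h <;> [skip; rcases eq_or_ne x (j + 1) with rfl | h'] <;>
      simp_all [Equiv.swap_apply_of_ne_of_ne]
  · set J' := J.map (Equiv.swap j (j + 1)).toEmbedding with hJ'
    have h₁' : j ∈ J' := by rw [hm]; simpa using h₂
    have h₂' : j + 1 ∉ J' := by rw [hm]; simpa using h₁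
    convert exists_path_return hN h₁' h₂' using 3
    ext x
    simp only [Finset.mem_insert, Finset.mem_erase, hm]
    rcases eq_or_ne x j with rfl | h <;> [skip; rcases eq_or_ne x (j + 1) with rfl | h'] <;>
      simp_all [Equiv.swap_apply_of_ne_of_ne]
  · refine ⟨[], ?_⟩
    ext x
    rw [hm]
    rcases eq_or_ne x j with rfl | h <;> [skip; rcases eq_or_ne x (j + 1) with rfl | h'] <;>
      simp_all [Equiv.swap_apply_of_ne_of_ne]

/-- Adjacent transpositions generate the symmetric group, and each is realised by a path. -/
theorem exists_path_perm (J : Config N) (σ : Equiv.Perm (ZMod N)) :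
    ∃ w, Path w J (J.map σ.toEmbedding) := by
  obtain ⟨n, rfl⟩ : ∃ n, N = n + 1 := ⟨N - 1, by omega⟩
  have hσ : σ ∈ Submonoid.closure
      (Set.range fun i : Fin n => (Equiv.swap i.castSucc i.succ : Equiv.Perm (Fin (n + 1)))) := by
    rw [Equiv.Perm.mclosure_swap_castSucc_succ]; trivial
  induction hσ using Submonoid.closure_induction_left with
  | one => exact ⟨[], Finset.map_refl⟩
  | mul_left s hs τ _ ih =>
    obtain ⟨w, hw⟩ := ih
    obtain ⟨i, rfl⟩ := hs
    obtain ⟨a, ha⟩ : ∃ a : ZMod (n + 1), a = i.castSucc := ⟨_, rfl⟩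
    obtain ⟨v, hv⟩ := exists_path_swap hN (J.map τ.toEmbedding) a
    refine ⟨v ++ w, path_append.2 ⟨_, hw, ?_⟩⟩
    have hi : a + 1 = i.succ := ha ▸ Fin.coeSucc_eq_succ
    rw [hi, ha, Finset.map_map] at hv
    exact hv

theorem exists_path_of_card_eq {J I : Config N} (h : J.card = I.card) : ∃ w, Path w J I := by
  have : NeZero N := ⟨by omega⟩
  let f : {x // x ∈ J} ≃ {x // x ∈ I} := Finset.equivOfCardEq h
  obtain ⟨w, hw⟩ := exists_path_perm hN J f.extendSubtype
  refine ⟨w, ?_⟩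
  have : J.map f.extendSubtype.toEmbedding = I := by
    refine Finset.eq_of_subset_of_card_le (fun x hx => ?_) (by simp [h])
    obtain ⟨y, hy, rfl⟩ := Finset.mem_map.1 hx
    exact f.extendSubtype_mem y hy
  rwa [this] at hw

theorem exists_gap {I : Config N} (h₁ : 1 ≤ I.card) (h₂ : I.card ≤ N - 1) :
    ∃ g, g ∈ I ∧ g + 1 ∉ I := by
  have : NeZero N := ⟨by omega⟩
  by_contra! h
  obtain ⟨x, hx⟩ := Finset.card_pos.1 h₁
  have : I = Finset.univ := Finset.eq_univ_iff_forall.2 fun y => by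
    have : ∀ n : ℕ, x + n ∈ I := fun n => by
      induction n with
      | zero => simpa using hx
      | succ n ih => have := h _ ih; push_cast; rwa [← add_assoc]
    simpa using this (y - x).val
  rw [this, Finset.card_univ, ZMod.card] at h₂
  omega

end Reachability

/-! ### Minimal monomials and multiplication by `t_k` -/

section MinimalMonomials

variable (hN : 3 ≤ N)
include hN

theorem exists_moves (p : ConfigPair N) : ∃ w m, Moves 𝕜 N w p.1.1 p.1.2 m := by
  obtain ⟨⟨I, J⟩, h, h₁, h₂⟩ := p
  obtain ⟨g, hg, hg'⟩ := exists_gap hN h₁ h₂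
  obtain ⟨w, hw⟩ := exists_path_of_card_eq hN h.symm
  -- The path `w` may leave particles at rest; the special word contains every letter, so prepending
  -- it moves them all without changing the endpoint.
  exact ⟨hatWord N I g ++ w, _, moves_iff.2 ⟨path_append.2 ⟨I, hw, path_hatWord hN hg hg'⟩, rfl,
    fun x _ => List.mem_append_left _ (mem_hatWord hN I g x)⟩⟩

theorem exists_minimal_moves (p : ConfigPair N) : ∃ w m, Moves 𝕜 N w p.1.1 p.1.2 m ∧
    ∀ w' m', Moves 𝕜 N w' p.1.1 p.1.2 m' → m ≤ m' := by
  classical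
  have h : ∃ m w, Moves 𝕜 N w p.1.1 p.1.2 m := exists_comm.1 (exists_moves hN p)
  obtain ⟨w, hw⟩ := Nat.find_spec h
  exact ⟨w, _, hw, fun w' m' h' => Nat.find_min' h ⟨w', h'⟩⟩

theorem isMinMono_unique {I J : Config N} {x y : Alg 𝕜 N} (hx : IsMinMono 𝕜 N I J x)
    (hy : IsMinMono 𝕜 N I J y) : x = y := by
  obtain ⟨w, m, rfl, hw, hm⟩ := hx
  obtain ⟨w', m', rfl, hw', hm'⟩ := hy
  have hmm : m = m' := le_antisymm (hm _ _ hw') (hm' _ _ hw)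
  rw [moves_iff] at hw hw'
  exact mono_eq_of_path hN hw.1 hw'.1
    (count_eq_of_path hN hw.1 hw'.1 (by rw [hw.2.1, hw'.2.1, hmm]))

theorem e_eq_of_isMinMono {I J : Config N} {x : Alg 𝕜 N} (hx : IsMinMono 𝕜 N I J x) :
    e 𝕜 N I J = x := by
  have h : ∃ x, IsMinMono 𝕜 N I J x := ⟨x, hx⟩
  rw [e, dif_pos h]
  exact isMinMono_unique hN h.choose_spec hx

theorem isMinMono_hatWord {I : Config N} {g : ZMod N} (hg : g ∈ I) (hg' : g + 1 ∉ I) :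
    IsMinMono 𝕜 N I I (mono 𝕜 N (hatWord N I g)) := by
  refine ⟨_, 1, rfl, moves_iff.2 ⟨path_hatWord hN hg hg', count_hatWord hN I g 0,
    fun x _ => mem_hatWord hN I g x⟩, fun w m h => ?_⟩
  obtain ⟨hp, hm, hI⟩ := moves_iff.1 h
  by_contra hlt
  -- Exponent `0` would force the letter counts of the empty word, so `g` would not move.
  have h₀ : w.count 0 = ([] : List (ZMod N)).count 0 := by rw [List.count_nil]; omega
  have := count_eq_of_path hN hp (w' := []) rfl h₀ g
  exact List.count_eq_zero.1 this (hI g hg)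

theorem aHat_eq {I : Config N} {g : ZMod N} (hg : g ∈ I) (hg' : g + 1 ∉ I) :
    aHat 𝕜 N I = mono 𝕜 N (hatWord N I g) := by
  have h : ∃ g, g ∈ I ∧ g + 1 ∉ I := ⟨g, hg, hg'⟩
  rw [aHat, dif_pos h]
  exact isMinMono_unique hN (isMinMono_hatWord hN h.choose_spec.1 h.choose_spec.2)
    (isMinMono_hatWord hN hg hg')

/-- If the product were nonzero, `w` would move some `J₁ ⊇ J` to a `K` on which the special word
acts. Minimality of moved configurations gives `K ⊆ I'`, and conservation gives `I ⊆ K`; equal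
cardinalities then force `I' = I`. -/
theorem mono_hatWord_append_eq_zero {I I' J : Config N} {g : ZMod N} {w : List (ZMod N)}
    (hg : g ∈ I') (hg' : g + 1 ∉ I') (h : Path w J I) (hJ : ∀ x ∈ J, x ∈ w)
    (hc : I'.card = I.card) (hne : I' ≠ I) : mono 𝕜 N (hatWord N I' g ++ w) = 0 := by
  by_contra h₀
  obtain ⟨J₁, I₁, hp, -⟩ := exists_path_of_mono_ne_zero hN h₀
  obtain ⟨K, hK, hK'⟩ := path_append.1 hp
  have h₁ : J ⊆ J₁ := subset_of_path hN h hK hJ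
  have h₂ : K ⊆ I' :=
    subset_of_path hN hK' (path_hatWord hN hg hg') fun x _ => mem_hatWord hN I' g x
  have h₃ : I ⊆ K := fun x hx => by
    have c := h.conservation hN x
    have c' := hK.conservation hN x
    rw [if_pos hx] at c
    by_contra hxK
    rw [if_neg hxK] at c'
    by_cases hxJ : x ∈ J
    · rw [if_pos hxJ] at c
      rw [if_pos (h₁ hxJ)] at c'
      omega
    · rw [if_neg hxJ] at c
      omega
  exact hne (Finset.eq_of_subset_of_card_le (h₃.trans h₂) hc.le).symm

theorem t_mul_mono [NeZero N] {I J : Config N} {g : ZMod N} {w : List (ZMod N)} (hg : g ∈ I)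
    (hg' : g + 1 ∉ I) (h₂ : I.card ≤ N - 1) (h : Path w J I) (hJ : ∀ x ∈ J, x ∈ w) :
    t 𝕜 N I.card * mono 𝕜 N w = (-1 : 𝕜) ^ (I.card - 1) • mono 𝕜 N (hatWord N I g ++ w) := by
  rw [t, smul_mul_assoc, Finset.sum_mul, Finset.sum_eq_single I]
  · rw [aHat_eq hN hg hg', mono_append]
  · intro I' hI' hne
    have hc := (Finset.mem_powersetCard.1 hI').2
    obtain ⟨g', h₁, h₁'⟩ := exists_gap hN (I := I') (by rw [hc]; exact Finset.card_pos.2 ⟨g, hg⟩)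
      (by rwa [hc])
    rw [aHat_eq hN h₁ h₁', ← mono_append, mono_hatWord_append_eq_zero hN h₁ h₁' h hJ hc hne]
  · intro hI
    exact absurd (Finset.mem_powersetCard.2 ⟨Finset.subset_univ _, rfl⟩) hI

/-- The elements `t_k^ℓ e_{IJ}` are, up to sign, the monomials that move `J` to `I`, every particle
by at least one step. -/
theorem exists_words [NeZero N] (p : ConfigPair N) : ∃ (m : ℕ) (W : ℕ → List (ZMod N)),
    (∀ l, t 𝕜 N p.1.1.card ^ l * e 𝕜 N p.1.1 p.1.2 =
        (-1 : 𝕜) ^ (l * (p.1.1.card - 1)) • mono 𝕜 N (W l) ∧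
      Moves 𝕜 N (W l) p.1.1 p.1.2 (m + l)) ∧
    ∀ w' m', Moves 𝕜 N w' p.1.1 p.1.2 m' → m ≤ m' := by
  obtain ⟨w, m, hw, hm⟩ := exists_minimal_moves (𝕜 := 𝕜) hN p
  have he := e_eq_of_isMinMono hN ⟨w, m, rfl, hw, hm⟩
  obtain ⟨⟨I, J⟩, h, h₁, h₂⟩ := p
  obtain ⟨g, hg, hg'⟩ := exists_gap hN h₁ h₂
  dsimp only at *
  refine ⟨m, fun l => l.rec w fun _ u => hatWord N I g ++ u, fun l => ?_, hm⟩
  induction l with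
  | zero => simpa [he] using hw
  | succ l ih =>
    obtain ⟨h₃, h₄⟩ := ih
    obtain ⟨h₄, h₅, h₆⟩ := moves_iff.1 h₄
    refine ⟨?_, moves_iff.2 ⟨path_append.2 ⟨I, h₄, path_hatWord hN hg hg'⟩, ?_, ?_⟩⟩
    · rw [pow_succ', mul_assoc, h₃, mul_smul_comm, t_mul_mono hN hg hg' h₂ h₄ h₆, smul_smul,
        ← pow_add, add_mul, one_mul]
    · rw [List.count_append, count_hatWord hN, h₅]; omega
    · exact fun x _ => List.mem_append_left _ (mem_hatWord hN I g x)

end MinimalMonomials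

/-! ### The representation and its coordinate functionals -/

section Representation

theorem end_ext {f f' : Module.End 𝕜[X] (Fock 𝕜 N)}
    (h : ∀ I, f (wedge 𝕜 N I) = f' (wedge 𝕜 N I)) : f = f' :=
  Finsupp.lhom_ext' fun I => LinearMap.ext_ring (h I)

variable (hN : 3 ≤ N)
include hN

/-- By conservation, neighbouring letter counts along a path differ by at most one. The square and
braid relations violate this bound, so they act as zero. -/
theorem not_path_of_count {w : List (ZMod N)} {x : ZMod N}
    (h : w.count x + 2 ≤ w.count (x - 1) ∨ w.count (x - 1) + 2 ≤ w.count x) (J I : Config N) :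
    ¬ Path w J I := fun hp => by
  have c := hp.conservation hN x
  have a (K : Config N) : (if x ∈ K then 1 else 0) ≤ 1 := by split <;> simp
  have := a I
  have := a J
  omega

theorem genAct_mul_comm {i j : ZMod N} (h₁ : i - j ≠ 1) (h₂ : i - j ≠ -1) :
    genAct 𝕜 N i * genAct 𝕜 N j = genAct 𝕜 N j * genAct 𝕜 N i := by
  rcases eq_or_ne i j with rfl | h₀
  · rfl
  have key : ∀ J I, Path [i, j] J I ↔ Path [j, i] J I := fun J I => by
    constructor <;> refine fun h => path_swap hN h ?_ ?_ ?_
    · exact h₀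
    · rintro rfl; simp at h₂
    · rintro rfl; simp at h₁
    · exact h₀.symm
    · rintro rfl; simp at h₁
    · rintro rfl; simp at h₂
  have : wordAct 𝕜 N [i, j] = wordAct 𝕜 N [j, i] := end_ext fun J => by
    by_cases h : ∃ I, Path [i, j] J I
    · obtain ⟨I, h⟩ := h
      rw [wordAct_of_path h, wordAct_of_path ((key J I).1 h), (List.Perm.swap j i []).count_eq]
    · push Not at h
      rw [wordAct_of_forall_not_path h,
        wordAct_of_forall_not_path fun I hI => h I ((key J I).2 hI)]
  simpa [wordAct] using this

theorem wordAct_eq_zero_of_count {w : List (ZMod N)} (x : ZMod N)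
    (h : w.count x + 2 ≤ w.count (x - 1) ∨ w.count (x - 1) + 2 ≤ w.count x) :
    wordAct 𝕜 N w = 0 :=
  end_ext fun J => wordAct_of_forall_not_path (not_path_of_count hN h J)

/-- The action of the affine nilTemperley-Lieb algebra on the particle configurations. -/
noncomputable def rep : Alg 𝕜 N →ₐ[𝕜] Module.End 𝕜[X] (Fock 𝕜 N) :=
  RingQuot.liftAlgHom 𝕜 ⟨FreeAlgebra.lift 𝕜 (genAct 𝕜 N), fun x y h => by
    have e₁ := sub_one_ne hN
    have e₂ := add_one_ne hN
    have e₃ := sub_one_ne_add_one hN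
    cases h with
    | sq i =>
      have := wordAct_eq_zero_of_count (𝕜 := 𝕜) hN (w := [i, i]) i (by simp [(e₁ i).symm])
      simpa [wordAct] using this
    | comm i j h₁ h₂ => simpa using genAct_mul_comm hN h₁ h₂
    | braid i =>
      have := wordAct_eq_zero_of_count (𝕜 := 𝕜) hN (w := [i, i + 1, i]) i
        (by simp [e₂ i, (e₁ i).symm, (e₃ i).symm])
      simpa [wordAct, mul_assoc] using this
    | braid' i =>
      have := wordAct_eq_zero_of_count (𝕜 := 𝕜) hN (w := [i + 1, i, i + 1]) (i + 1 + 1)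
        (by simp [(e₂ i).symm, (e₂ (i + 1)).symm,
          show i ≠ i + 1 + 1 from fun h => e₃ (i + 1) (by rwa [add_sub_cancel_right])])
      simpa [wordAct, mul_assoc] using this⟩

theorem rep_mono (w : List (ZMod N)) : rep hN (mono 𝕜 N w) = wordAct 𝕜 N w := by
  have h : ∀ j, rep hN (gen 𝕜 N j) = genAct 𝕜 N j := fun j => by
    rw [rep, gen, RingQuot.liftAlgHom_mkAlgHom_apply, FreeAlgebra.lift_ι_apply]
  rw [mono, wordAct, map_list_prod, List.map_map]
  congr 2
  exact funext h

/-- The coefficient of `q^d v(I)` in `x v(J)`. -/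
noncomputable def coord (J I : Config N) (d : ℕ) : Alg 𝕜 N →ₗ[𝕜] 𝕜 where
  toFun x := (rep hN x (wedge 𝕜 N J) I).coeff d
  map_add' x y := by simp
  map_smul' c x := by simp

theorem coord_mono_ne_zero_iff {J I : Config N} {d : ℕ} {w : List (ZMod N)} :
    coord hN J I d (mono 𝕜 N w) ≠ 0 ↔ Path w J I ∧ w.count 0 = d := by
  change (rep hN (mono 𝕜 N w) (wedge 𝕜 N J) I).coeff d ≠ 0 ↔ _
  rw [rep_mono]
  by_cases h : ∃ K, Path w J K
  · obtain ⟨K, hK⟩ := h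
    rw [wordAct_of_path hK]
    rcases eq_or_ne I K with rfl | hne
    · rw [smul_wedge_apply]
      rcases neg_one_pow_mul_X_pow (𝕜 := 𝕜) (J.card - 1) (w.count 0) with e | e <;>
        simp [e, coeff_X_pow, hK, eq_comm]
    · rw [smul_wedge_apply_of_ne _ hne]
      simp only [coeff_zero, ne_eq, not_true_eq_false, false_iff, not_and]
      exact fun h => absurd (h.unique hK) hne
  · push Not at h
    rw [wordAct_of_forall_not_path h]
    simp [h]

end Representation

/-! ### Triangularity, spanning monomials and the basis -/

theorem linearIndependent_of_triangular {K M ι : Type*} [Field K] [AddCommGroup M] [Module K M]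
    (v : ι → M) (r : ι → ℕ) (φ : ι → M →ₗ[K] K) (h₁ : ∀ i, φ i (v i) ≠ 0)
    (h₂ : ∀ i j, φ i (v j) ≠ 0 → j = i ∨ r j < r i) : LinearIndependent K v := by
  rw [linearIndependent_iff]
  intro c hc
  suffices ∀ n i, r i = n → c i = 0 from Finsupp.ext fun i => this _ i rfl
  intro n
  induction n using Nat.strong_induction_on with
  | _ n ih =>
    rintro i rfl
    have h := congrArg (φ i) hc
    rw [Finsupp.linearCombination_apply, Finsupp.sum, map_sum, map_zero,
      Finset.sum_eq_single i] at h
    · simpa [h₁ i] using h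
    · intro j _ hj
      by_contra hne
      rw [map_smul, smul_eq_mul] at hne
      exact hne (by rw [ih _ ((h₂ i j (right_ne_zero_of_mul hne)).resolve_left hj) j rfl, zero_mul])
    · intro hi
      rw [Finsupp.notMem_support_iff.1 hi, zero_smul, map_zero]

theorem span_range_mono : Submodule.span 𝕜 (Set.range (mono 𝕜 N)) = ⊤ := by
  have h : Algebra.adjoin 𝕜 (Set.range (gen 𝕜 N)) = ⊤ := by
    have : Set.range (gen 𝕜 N) =
        RingQuot.mkAlgHom 𝕜 (Rel 𝕜 N) '' Set.range (FreeAlgebra.ι 𝕜) := by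
      rw [← Set.range_comp]; rfl
    rw [this, ← AlgHom.map_adjoin, FreeAlgebra.adjoin_range_ι, Algebra.map_top,
      AlgHom.range_eq_top]
    exact RingQuot.mkAlgHom_surjective 𝕜 _
  rw [eq_top_iff, ← Algebra.top_toSubmodule, ← h, Algebra.adjoin_eq_span]
  refine Submodule.span_mono fun x hx => ?_
  obtain ⟨L, hL, rfl⟩ := Submonoid.exists_list_of_mem_closure hx
  obtain ⟨w, rfl⟩ : L ∈ Set.range (List.map (gen 𝕜 N)) := by rwa [Set.range_list_map]
  exact ⟨w, rfl⟩

/-- The configuration moved by a nonempty word is neither empty nor full. -/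
theorem Path.card_bounds [NeZero N] {w : List (ZMod N)} {J I : Config N} (h : Path w J I)
    (hw : w ≠ []) : 1 ≤ J.card ∧ J.card ≤ N - 1 := by
  rw [← List.dropLast_append_getLast hw] at h
  obtain ⟨K, hK, -⟩ := path_append.1 h
  obtain ⟨h₁, h₂, -⟩ := path_singleton.1 hK
  refine ⟨Finset.card_pos.2 ⟨_, h₁⟩, Nat.le_sub_one_of_lt ?_⟩
  simpa [ZMod.card] using Finset.card_lt_univ_of_notMem h₂

end AffNTL

theorem theorem7p4 (𝕜 : Type*) [Field 𝕜] (N : ℕ) [NeZero N] (hN : 3 ≤ N) :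
    -- `e_{IJ}` is well defined
    (∀ p : AffNTL.ConfigPair N,
      (∃! x : AffNTL.Alg 𝕜 N, AffNTL.IsMinMono 𝕜 N p.1.1 p.1.2 x) ∧
        AffNTL.IsMinMono 𝕜 N p.1.1 p.1.2 (AffNTL.e 𝕜 N p.1.1 p.1.2)) ∧
    -- `e_{II}` is the special monomial of `I`, formed with any gap of `I`
    (∀ (I : AffNTL.Config N) (g : ZMod N), g ∈ I → g + 1 ∉ I →
      AffNTL.e 𝕜 N I I = AffNTL.mono 𝕜 N (AffNTL.hatWord N I g) ∧
        AffNTL.aHat 𝕜 N I = AffNTL.mono 𝕜 N (AffNTL.hatWord N I g)) ∧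
    -- `t_k^ℓ e_{IJ}` is, up to sign, a monomial
    (∀ (l : ℕ) (p : AffNTL.ConfigPair N), ∃ w : List (ZMod N),
      AffNTL.t 𝕜 N p.1.1.card ^ l * AffNTL.e 𝕜 N p.1.1 p.1.2 =
        (-1 : 𝕜) ^ (l * (p.1.1.card - 1)) • AffNTL.mono 𝕜 N w) ∧
    -- together with `1`, these elements form a basis
    ∃ b : Module.Basis (Option (ℕ × AffNTL.ConfigPair N)) 𝕜 (AffNTL.Alg 𝕜 N),
      b none = 1 ∧
      ∀ (l : ℕ) (p : AffNTL.ConfigPair N),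
        b (some (l, p)) = AffNTL.t 𝕜 N p.1.1.card ^ l * AffNTL.e 𝕜 N p.1.1 p.1.2 := by
  open AffNTL in
  choose m W hW hm using exists_words (𝕜 := 𝕜) hN
  have hsign : ∀ n : ℕ, ((-1 : 𝕜) ^ n) ≠ 0 := fun n => pow_ne_zero _ (by simp)
  refine ⟨fun p => ?_, fun I g hg hg' => ⟨e_eq_of_isMinMono hN (isMinMono_hatWord hN hg hg'),
    aHat_eq hN hg hg'⟩, fun l p => ⟨W p l, (hW p l).1⟩, ?_⟩
  · obtain ⟨w, m, hw, hm⟩ := exists_minimal_moves (𝕜 := 𝕜) hN p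
    have h : IsMinMono 𝕜 N p.1.1 p.1.2 (mono 𝕜 N w) := ⟨w, m, rfl, hw, hm⟩
    exact ⟨⟨_, h, fun y hy => isMinMono_unique hN hy h⟩, by rwa [e_eq_of_isMinMono hN h]⟩
  let v : Option (ℕ × ConfigPair N) → Alg 𝕜 N := fun o =>
    o.elim 1 fun q => t 𝕜 N q.2.1.1.card ^ q.1 * e 𝕜 N q.2.1.1 q.2.1.2
  have hv : ∀ l p, v (some (l, p)) =
      (-1 : 𝕜) ^ (l * (p.1.1.card - 1)) • mono 𝕜 N (W p l) := fun l p => (hW p l).1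
  have hli : LinearIndependent 𝕜 v := by
    -- The rank is `|J|`. The label `1` gets rank `0` and the functional of the empty configuration,
    -- which every other member of the family kills.
    refine linearIndependent_of_triangular v (fun o => o.elim 0 fun q => q.2.1.2.card)
      (fun o => o.elim (coord hN ∅ ∅ 0) fun q => coord hN q.2.1.2 q.2.1.1 (m q.2 + q.1)) ?_ ?_
    · rintro (_ | ⟨l, p⟩)
      · change coord hN ∅ ∅ 0 (1 : Alg 𝕜 N) ≠ 0
        rw [← mono_nil, coord_mono_ne_zero_iff]
        exact ⟨rfl, rfl⟩
      · obtain ⟨h₁, h₂, -⟩ := moves_iff.1 (hW p l).2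
        rw [hv, map_smul, smul_ne_zero_iff]
        exact ⟨hsign _, (coord_mono_ne_zero_iff hN).2 ⟨h₁, h₂⟩⟩
    · rintro (_ | ⟨l, p⟩) (_ | ⟨l', p'⟩) h
      · exact Or.inl rfl
      · rw [hv, map_smul, smul_ne_zero_iff] at h
        have h₁ := ((coord_mono_ne_zero_iff hN).1 h.2).1
        obtain ⟨h₂, -, h₃⟩ := moves_iff.1 (hW p' l').2
        have h₄ := Finset.card_le_card (subset_of_path hN h₂ h₁ h₃)
        have := p'.2.1
        have := p'.2.2.1
        rw [Finset.card_empty] at h₄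
        omega
      · right
        have := p.2.1
        have := p.2.2.1
        change 0 < p.1.2.card
        omega
      · rw [hv, map_smul, smul_ne_zero_iff] at h
        obtain ⟨h₁, h₁'⟩ := (coord_mono_ne_zero_iff hN).1 h.2
        obtain ⟨h₂, h₂', h₃⟩ := moves_iff.1 (hW p' l').2
        have h₄ := subset_of_path hN h₂ h₁ h₃
        -- With equal sources the word has only one endpoint, so the targets agree, and the
        -- exponents `m + l'` and `m + l` then give `l' = l`.
        rcases h₄.eq_or_ssubset with h₅ | h₅
        · left
          obtain ⟨⟨I, J⟩, hp⟩ := p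
          obtain ⟨⟨I', J'⟩, hp'⟩ := p'
          obtain rfl : J' = J := h₅
          obtain rfl : I' = I := h₂.unique h₁
          dsimp only at h₁'
          rw [show l' = l by omega]
        · exact Or.inr (Finset.card_lt_card h₅)
  have hsp : ⊤ ≤ Submodule.span 𝕜 (Set.range v) := by
    rw [← span_range_mono, Submodule.span_le]
    rintro _ ⟨w, rfl⟩
    by_cases h₀ : mono 𝕜 N w = 0
    · rw [h₀]; exact Submodule.zero_mem _
    rcases eq_or_ne w [] with rfl | hw
    · exact Submodule.subset_span ⟨none, by simp [v]⟩
    obtain ⟨J, I, hp, hJ⟩ := exists_path_of_mono_ne_zero hN h₀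
    have hb := hp.card_bounds hw
    let p : ConfigPair N := ⟨(I, J), hp.card_eq, by rwa [hp.card_eq]⟩
    -- The power of `t_k` is the excess of the exponent of `w` over the minimal one.
    obtain ⟨l, hl⟩ := Nat.exists_eq_add_of_le (hm p w _ (moves_iff.2 ⟨hp, rfl, hJ⟩))
    obtain ⟨h₁, h₂, -⟩ := moves_iff.1 (hW p l).2
    have : mono 𝕜 N w = mono 𝕜 N (W p l) :=
      mono_eq_of_path hN hp h₁ (count_eq_of_path hN hp h₁ (by rw [h₂, hl]))
    rw [this, ← inv_smul_smul₀ (hsign (l * (p.1.1.card - 1))) (mono 𝕜 N (W p l)), ← hv]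
    exact Submodule.smul_mem _ _ (Submodule.subset_span ⟨_, rfl⟩)
  exact ⟨Module.Basis.mk hli hsp, by simp [v], fun l p => by simp [v]⟩
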